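/- Consider $n$ buyers with budgets $B_i\ge 0$, $m$ divisible goods, and valuations $v_{ij}:[0,\infty)\to\mathbb R$ that are concave, nondecreasing and satisfy $v_{ij}(0)=0$. Let $\mathrm{RMVUP}$ be the optimal revenue with variable unit prices, i.e. the supremum of $\sum_{i,j} b_{ij}$ over all $x_{ij}\ge 0$, $b_{ij}\ge 0$ with $\sum_i x_{ij}\le 1$ for all $j$, $\sum_j b_{ij}\le B_i$ for all $i$, and $b_{ij}\le v_{ij}(x_{ij})$ for all $i,j$. Consider the primal program $$\max_{u,\delta,x}\ \sum_{i}\big(B_i\ln u_i-\delta_i\big)\quad\text{s.t.}\quad u_i\le\sum_j v_{ij}(x_{ij})+\delta_i\ \ \forall i,\qquad \sum_i x_{ij}\le 1\ \ \forall j,\qquad u_i,\delta_i,x_{ij}\ge 0,$$ and the dual program $$\min_{\alpha,p}\ \sum_i\Big(B_i\ln\frac{B_i}{\alpha_i}-B_i\Big)+\sum_j p_j+\sum_{i,j}\sup_{t\ge 0}\big(\alpha_i v_{ij}(t)-p_j t\big)\quad\text{s.t.}\quad 0<\alpha_i\le 1\ \ \forall i,\qquad p_j\ge 0\ \ \forall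 j,$$ with the conventions $\ln 0=-\infty$ and $0\ln 0=0$. Solutions of either program are understood to have a finite objective value. Let $(x,u,\delta)$ be an optimal solution of the primal program and $(\alpha,p)$ an optimal solution of the dual program. Then: 1. (Individual rationality) $p_j x_{ij}\le v_{ij}(x_{ij})$ for all $i,j$. 2. (Budget feasibility) $\sum_j p_j x_{ij}\le B_i$ for all $i$. 3. (Revenue) Suppose that every $v_{ij}$ has a finite right derivative $v_{ij}'(0)$ at $0$ and is differentiable at $1$, with $v'_{ij}(1)>0$ unless $v_{ij}\equiv 0$. Put $r:=\max_{i,j} v'_{ij}(0)/v'_{ij}(1)$, where valuations $v_{ij}\equiv 0$ contribute the ratio $0$ (and $r:=0$ if there are no buyers or no goods). Then $$\sum_{i,j}p_j x_{ij}\ \ge\ \frac{1}{\rho(\rho+1)}\cdot \mathrm{RMVUP}$$ holds for $\rho:=r$. If moreover every $v_{ij}$ is differentiable on $(0,1)$ and $t\mapsto t\,v'_{ij}(t)$ is nondecreasing on $(0,1]$, then the same inequality holds for $\rho:=1+\ln r$ and also for $\rho:=\log_2(1+r)$. (If all valuations vanish identically or there are no buyers or no goods, then $r=0$ and $\mathrm{RMVUP}=0$;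 in that case $1/(\rho(\rho+1))$ is read as $0$ when $\rho=0$, $\ln r$ is read as $0$, and the inequality is trivial.) -/

import Mathlib

/-!
Markets with `n` buyers with budgets `B i`, `m` divisible goods, and valuations `v i j`, where
`v i j t` is the value that buyer `i` derives from the quantity `t ≥ 0` of good `j`.
An allocation is a matrix `x`, with `x i j` the quantity of good `j` given to buyer `i`.
-/

noncomputable section

namespace ConcaveMarket

variable {n m : ℕ}

/-- A valuation: a concave, nondecreasing function on `[0, ∞)` that vanishes at `0`. -/
structure IsValuation (f : ℝ → ℝ) : Prop where
  zero : f 0 = 0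
  mono : MonotoneOn f (Set.Ici 0)
  concave : ConcaveOn ℝ (Set.Ici 0) f

/-! ### The revenue benchmark with variable unit prices -/

/-- Feasibility of an allocation `x` with payments `b` in the program RMVUP. -/
structure RMVUPFeasible (B : Fin n → ℝ) (v : Fin n → Fin m → ℝ → ℝ)
    (x b : Fin n → Fin m → ℝ) : Prop where
  supply : ∀ j, ∑ i, x i j ≤ 1
  budget : ∀ i, ∑ j, b i j ≤ B i
  rational : ∀ i j, b i j ≤ v i j (x i j)
  x_nonneg : ∀ i j, 0 ≤ x i j
  b_nonneg : ∀ i j, 0 ≤ b i j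

/-- The optimal revenue with variable unit prices. For nonnegative budgets this is the supremum of
a nonempty set of reals that is bounded above by the sum of the budgets. -/
def RMVUP (B : Fin n → ℝ) (v : Fin n → Fin m → ℝ → ℝ) : ℝ :=
  sSup {R | ∃ x b, RMVUPFeasible B v x b ∧ R = ∑ i, ∑ j, b i j}

/-! ### The primal program -/

/-- The constraints of the primal program. The field `u_pos` says that the objective is not `-∞`
(with the usual conventions `ln 0 = -∞` and `0 * ln 0 = 0`). -/
structure PrimalFeasible (B : Fin n → ℝ) (v : Fin n → Fin m → ℝ → ℝ)
    (x : Fin n → Fin m → ℝ) (u δ : Fin n → ℝ) : Prop where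
  utility : ∀ i, u i ≤ ∑ j, v i j (x i j) + δ i
  supply : ∀ j, ∑ i, x i j ≤ 1
  u_nonneg : ∀ i, 0 ≤ u i
  δ_nonneg : ∀ i, 0 ≤ δ i
  x_nonneg : ∀ i j, 0 ≤ x i j
  u_pos : ∀ i, 0 < B i → 0 < u i

/-- The objective of the primal program. -/
def primalObj (B u δ : Fin n → ℝ) : ℝ :=
  ∑ i, (B i * Real.log (u i) - δ i)

/-- `(x, u, δ)` is an optimal solution of the primal program. -/
structure IsPrimalSolution (B : Fin n → ℝ) (v : Fin n → Fin m → ℝ → ℝ)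
    (x : Fin n → Fin m → ℝ) (u δ : Fin n → ℝ) : Prop where
  feasible : PrimalFeasible B v x u δ
  optimal : ∀ x' u' δ', PrimalFeasible B v x' u' δ' → primalObj B u' δ' ≤ primalObj B u δ

/-! ### The dual program -/

/-- The constraints of the dual program. The field `bdd` says that the suprema in the objective
are finite, that is, that the objective is not `+∞`. -/
structure DualFeasible (v : Fin n → Fin m → ℝ → ℝ)
    (α : Fin n → ℝ) (p : Fin m → ℝ) : Prop where
  α_pos : ∀ i, 0 < α i
  α_le_one : ∀ i, α i ≤ 1
  p_nonneg : ∀ j, 0 ≤ p j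
  bdd : ∀ i j, BddAbove ((fun t : ℝ => α i * v i j t - p j * t) '' Set.Ici 0)

/-- The objective of the dual program (for `B i = 0` the term `B i * ln (B i / α i)` is `0`). -/
def dualObj (B : Fin n → ℝ) (v : Fin n → Fin m → ℝ → ℝ)
    (α : Fin n → ℝ) (p : Fin m → ℝ) : ℝ :=
  ∑ i, (B i * Real.log (B i / α i) - B i) + ∑ j, p j
    + ∑ i, ∑ j, sSup ((fun t : ℝ => α i * v i j t - p j * t) '' Set.Ici 0)

/-- `(α, p)` is an optimal solution of the dual program. -/
structure IsDualSolution (B : Fin n → ℝ) (v : Fin n → Fin m → ℝ → ℝ)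
    (α : Fin n → ℝ) (p : Fin m → ℝ) : Prop where
  feasible : DualFeasible v α p
  optimal : ∀ α' p', DualFeasible v α' p' → dualObj B v α p ≤ dualObj B v α' p'

/-! ### Slopes of the valuations -/

/-- A valuation has a finite slope at `0` (from the right) and is differentiable at `1`, with
positive derivative there unless it is the zero valuation. -/
structure RegularSlopes (f : ℝ → ℝ) : Prop where
  diff_zero : DifferentiableWithinAt ℝ f (Set.Ici 0) 0
  diff_one : DifferentiableAt ℝ f 1
  pos_or_zero : 0 < deriv f 1 ∨ ∀ t, 0 ≤ t → f t = 0

/-- The maximum over all pairs `(i, j)` of the ratio of the slope of `v i j` at `0` to its slope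
at `1`. (A zero valuation contributes `0 / 0 = 0`; all other ratios are at least `1`.) -/
def slopeRatio (v : Fin n → Fin m → ℝ → ℝ) : ℝ :=
  ⨆ ij : Fin n × Fin m,
    derivWithin (v ij.1 ij.2) (Set.Ici 0) 0 / deriv (v ij.1 ij.2) 1

end ConcaveMarket

end

namespace ConcaveMarket

variable {n m : ℕ}

/-! ### Elementary facts on valuations -/

/-! Strong duality (`strong_duality`) makes the two given solutions satisfy the conditions
`IsEquilibrium`: every buyer demands `x i j` at prices `p` under weights `α`, priced goods sell out,
and a buyer with `α i < 1` has `δ i = 0`. Comparing demand with `t = 0` gives `p j * x i j ≤ α i * v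
i j (x i j)`; this yields individual rationality and, summed over goods with `α i * u i = B i`,
budget feasibility.

For revenue, suppose `α i * v i j (x i j) ≤ ρ₀ * (p j * x i j)` throughout. A buyer with `α i < 1`
has a budget of at most `ρ₀` times their payment; for `α i = 1`, demand bounds the value of a rival
bundle `y` by `ρ₀` times the payment plus the price of `y`. As all rival bundles together cost at
most the revenue, `RMVUP` is at most `ρ₀ + 1` times the revenue (`IsEquilibrium.RMVUP_le`).
Concavity gives `ρ₀ = r`; monotone `t * v'(t)` gives `ρ₀ = 1 + log r`
(`IsValuation.le_one_add_log_mul`). The stated factors are weaker and follow by comparison. -/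

theorem IsValuation.nonneg {f : ℝ → ℝ} (hf : IsValuation f) {t : ℝ} (ht : 0 ≤ t) : 0 ≤ f t := by
  have := hf.mono (Set.mem_Ici.2 le_rfl) (Set.mem_Ici.2 ht) ht
  rwa [hf.zero] at this

theorem IsValuation.concave_le {f : ℝ → ℝ} (hf : IsValuation f) {s t θ : ℝ} (hs : 0 ≤ s)
    (ht : 0 ≤ t) (h0 : 0 ≤ θ) (h1 : θ ≤ 1) :
    (1 - θ) * f s + θ * f t ≤ f ((1 - θ) * s + θ * t) := by
  have := hf.concave.2 (Set.mem_Ici.2 hs) (Set.mem_Ici.2 ht) (sub_nonneg.2 h1) h0 (by ring)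
  simpa [smul_eq_mul] using this

/-- A valuation is bounded by an affine function. -/
theorem IsValuation.le_affine {f : ℝ → ℝ} (hf : IsValuation f) {t : ℝ} (ht : 0 ≤ t) :
    f t ≤ f 1 + f 1 * t := by
  have h1 := hf.nonneg zero_le_one
  rcases le_total t 1 with h | h
  · have := hf.mono (Set.mem_Ici.2 ht) (Set.mem_Ici.2 zero_le_one) h
    nlinarith [mul_nonneg h1 ht]
  · have ht0 : 0 < t := by linarith
    have := hf.concave_le le_rfl ht (inv_nonneg.2 ht) (inv_le_one_of_one_le₀ h)
    rw [hf.zero, mul_zero, zero_add, zero_add, inv_mul_cancel₀ ht0.ne'] at this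
    have h2 := mul_le_mul_of_nonneg_right this ht
    rw [mul_assoc, mul_comm (f t), ← mul_assoc, inv_mul_cancel₀ ht0.ne', one_mul] at h2
    linarith

/-! ### Strong duality -/

/-- First-order optimality of a primal solution, in the direction of `(y, δ')`. -/
theorem IsPrimalSolution.linearization {B : Fin n → ℝ} {v : Fin n → Fin m → ℝ → ℝ}
    (hv : ∀ i j, IsValuation (v i j)) {x : Fin n → Fin m → ℝ} {u δ : Fin n → ℝ}
    (h : IsPrimalSolution B v x u δ) (hB : ∀ i, 0 ≤ B i)
    {y : Fin n → Fin m → ℝ} {δ' : Fin n → ℝ} (hy : ∀ i j, 0 ≤ y i j)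
    (hys : ∀ j, ∑ i, y i j ≤ 1) (hδ' : ∀ i, 0 ≤ δ' i) :
    ∑ i, (B i / u i * (∑ j, v i j (y i j) + δ' i) - δ' i) ≤ ∑ i, (B i - δ i) := by
  have hf := h.feasible
  set w : Fin n → ℝ := fun i => ∑ j, v i j (y i j) + δ' i with hw
  have hw0 : ∀ i, 0 ≤ w i := fun i =>
    add_nonneg (Finset.sum_nonneg fun j _ => (hv i j).nonneg (hy i j)) (hδ' i)
  -- The objective along the segment from the solution to the competitor; its right derivative at
  -- `0` cannot be positive.
  set F : ℝ → ℝ := fun θ =>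
    ∑ i, (B i * Real.log (u i + θ * (w i - u i)) - (δ i + θ * (δ' i - δ i))) with hF
  have hderiv : HasDerivAt F (∑ i, (B i * ((w i - u i) / u i) - (δ' i - δ i))) 0 := by
    refine HasDerivAt.fun_sum fun i _ => ?_
    refine HasDerivAt.sub ?_ ?_
    · rcases (hB i).eq_or_lt with hi | hi
      · simpa [← hi] using hasDerivAt_const (0 : ℝ) (0 : ℝ)
      · have hu := hf.u_pos i hi
        have h1 : HasDerivAt (fun θ : ℝ => u i + θ * (w i - u i)) (w i - u i) 0 := by
          simpa using ((hasDerivAt_id (0 : ℝ)).mul_const (w i - u i)).const_add (u i)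
        have h2 := h1.log (by simpa using hu.ne')
        simpa using h2.const_mul (B i)
    · simpa using ((hasDerivAt_id (0 : ℝ)).mul_const (δ' i - δ i)).const_add (δ i)
  have hle : ∀ θ ∈ Set.Ioo (0 : ℝ) 1, F θ ≤ F 0 := by
    rintro θ ⟨h0, h1⟩
    have hopt := h.optimal (fun i j => (1 - θ) * x i j + θ * y i j)
      (fun i => u i + θ * (w i - u i)) (fun i => δ i + θ * (δ' i - δ i)) ?_
    · simpa [primalObj, hF] using hopt
    · have h1' : 0 ≤ 1 - θ := by linarith
      refine ⟨fun i => ?_, fun j => ?_, fun i => ?_, fun i => ?_, fun i j => ?_, fun i hi => ?_⟩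
      · have hc : (1 - θ) * ∑ j, v i j (x i j) + θ * ∑ j, v i j (y i j)
            ≤ ∑ j, v i j ((1 - θ) * x i j + θ * y i j) := by
          rw [Finset.mul_sum, Finset.mul_sum, ← Finset.sum_add_distrib]
          exact Finset.sum_le_sum fun j _ =>
            (hv i j).concave_le (hf.x_nonneg i j) (hy i j) h0.le h1.le
        have := mul_le_mul_of_nonneg_left (hf.utility i) h1'
        simp only [hw]
        linarith
      · rw [Finset.sum_add_distrib, ← Finset.mul_sum, ← Finset.mul_sum]
        nlinarith [mul_le_mul_of_nonneg_left (hf.supply j) h1',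
          mul_le_mul_of_nonneg_left (hys j) h0.le]
      · nlinarith [mul_nonneg h1' (hf.u_nonneg i), mul_nonneg h0.le (hw0 i)]
      · nlinarith [mul_nonneg h1' (hf.δ_nonneg i), mul_nonneg h0.le (hδ' i)]
      · exact add_nonneg (mul_nonneg h1' (hf.x_nonneg i j)) (mul_nonneg h0.le (hy i j))
      · nlinarith [mul_pos (sub_pos.2 h1) (hf.u_pos i hi), mul_nonneg h0.le (hw0 i)]
  have hslope := hderiv.tendsto_slope_zero_right
  have hnonpos : ∑ i, (B i * ((w i - u i) / u i) - (δ' i - δ i)) ≤ 0 := by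
    refine le_of_tendsto hslope ?_
    filter_upwards [Ioo_mem_nhdsGT (zero_lt_one' ℝ)] with θ hθ
    rw [zero_add, smul_eq_mul]
    exact mul_nonpos_of_nonneg_of_nonpos (inv_nonneg.2 hθ.1.le) (sub_nonpos.2 (hle θ hθ))
  rw [← sub_nonpos, ← Finset.sum_sub_distrib]
  refine le_of_eq_of_le (Finset.sum_congr rfl fun i _ => ?_) hnonpos
  rcases (hB i).eq_or_lt with hi | hi
  · simp [← hi]
    ring
  · have hu := (hf.u_pos i hi).ne'
    field_simp
    ring

/-- A Lagrange multiplier for a single resource constraint. -/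
theorem exists_price {f : Fin n → ℝ → ℝ} (hf : ∀ i, ConcaveOn ℝ (Set.Ici 0) (f i))
    {x : Fin n → ℝ} (hx : ∀ i, 0 ≤ x i) (hxs : ∑ i, x i ≤ 1)
    (hmax : ∀ y : Fin n → ℝ, (∀ i, 0 ≤ y i) → ∑ i, y i ≤ 1 → ∑ i, f i (y i) ≤ ∑ i, f i (x i)) :
    ∃ p : ℝ, 0 ≤ p ∧ p * ∑ i, x i = p ∧
      ∀ i t, 0 ≤ t → f i t - p * t ≤ f i (x i) - p * x i := by
  set M := ∑ i, f i (x i) with hM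
  -- Slopes of the value function from capacity `1` to larger capacities. Their supremum serves as
  -- the price; adjoining `0` makes it nonnegative.
  set S : Set ℝ := {q | q = 0 ∨ ∃ t : Fin n → ℝ, (∀ i, 0 ≤ t i) ∧ 1 < ∑ i, t i ∧
    q = (∑ i, f i (t i) - M) / (∑ i, t i - 1)} with hS
  have hcross : ∀ s : Fin n → ℝ, (∀ i, 0 ≤ s i) → ∑ i, s i < 1 →
      ∀ q ∈ S, q ≤ (M - ∑ i, f i (s i)) / (1 - ∑ i, s i) := by
    rintro s hs hs1 q (rfl | ⟨t, ht, ht1, rfl⟩)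
    · exact div_nonneg (sub_nonneg.2 (hmax s hs hs1.le)) (sub_nonneg.2 hs1.le)
    · set a := 1 - ∑ i, s i with ha
      set b := ∑ i, t i - 1 with hb
      have ha0 : 0 < a := sub_pos.2 hs1
      have hb0 : 0 < b := sub_pos.2 ht1
      -- With these weights the mixture of `t` and `s` uses exactly capacity `1`.
      have hab : a / (a + b) + b / (a + b) = 1 := by field_simp
      have hc := hmax (fun i => a / (a + b) * t i + b / (a + b) * s i)
        (fun i => by have := ht i; have := hs i; positivity) (by
          rw [Finset.sum_add_distrib, ← Finset.mul_sum, ← Finset.mul_sum,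
            show ∑ i, t i = 1 + b by rw [hb]; ring, show ∑ i, s i = 1 - a by rw [ha]; ring]
          apply le_of_eq
          field_simp
          ring)
      have hd : a / (a + b) * ∑ i, f i (t i) + b / (a + b) * ∑ i, f i (s i) ≤ M := by
        refine le_trans ?_ hc
        rw [Finset.mul_sum, Finset.mul_sum, ← Finset.sum_add_distrib]
        refine Finset.sum_le_sum fun i _ => ?_
        simpa [smul_eq_mul] using (hf i).2 (Set.mem_Ici.2 (ht i)) (Set.mem_Ici.2 (hs i))
          (by positivity : 0 ≤ a / (a + b)) (by positivity : 0 ≤ b / (a + b)) hab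
      rw [div_mul_eq_mul_div, div_mul_eq_mul_div, ← add_div, div_le_iff₀ (by positivity)] at hd
      rw [div_le_div_iff₀ hb0 ha0]
      linarith
  have hbdd : BddAbove S := by
    refine ⟨(M - ∑ i, f i ((fun _ : Fin n => (0 : ℝ)) i)) / (1 - ∑ i, (fun _ : Fin n => (0 : ℝ)) i),
      fun q hq => hcross (fun _ => 0) (fun _ => le_rfl) (by simp) q hq⟩
  have hp0 : 0 ≤ sSup S := le_csSup hbdd (Or.inl rfl)
  have hlag : ∀ t : Fin n → ℝ, (∀ i, 0 ≤ t i) →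
      ∑ i, f i (t i) - sSup S * ∑ i, t i + sSup S ≤ M := by
    intro t ht
    rcases lt_trichotomy (∑ i, t i) 1 with h | h | h
    · have := csSup_le (s := S) ⟨0, Or.inl rfl⟩ (hcross t ht h)
      rw [le_div_iff₀ (sub_pos.2 h)] at this
      linarith
    · rw [h]
      linarith [hmax t ht h.le]
    · have := le_csSup hbdd (Or.inr ⟨t, ht, h, rfl⟩)
      rw [div_le_iff₀ (sub_pos.2 h)] at this
      linarith
  have hcs : sSup S * ∑ i, x i = sSup S := by
    have h1 := hlag x hx
    have h2 := mul_le_mul_of_nonneg_left hxs hp0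
    linarith
  refine ⟨sSup S, hp0, hcs, fun i t ht => ?_⟩
  have h1 := hlag (Function.update x i t) (fun k => by
    by_cases hk : k = i
    · subst hk; simpa using ht
    · simpa [hk] using hx k)
  have h2 : ∑ k, (f k (Function.update x i t k) - sSup S * Function.update x i t k)
      = (f i t - sSup S * t) + ∑ k ∈ Finset.univ.erase i, (f k (x k) - sSup S * x k) := by
    rw [← Finset.add_sum_erase _ _ (Finset.mem_univ i), Function.update_self]
    congr 1
    refine Finset.sum_congr rfl fun k hk => ?_
    rw [Function.update_of_ne (Finset.ne_of_mem_erase hk)]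
  have h3 : ∑ k, (f k (x k) - sSup S * x k)
      = (f i (x i) - sSup S * x i) + ∑ k ∈ Finset.univ.erase i, (f k (x k) - sSup S * x k) :=
    (Finset.add_sum_erase _ _ (Finset.mem_univ i)).symm
  rw [Finset.sum_sub_distrib, ← Finset.mul_sum] at h2 h3
  linarith

/-- Prices and utility weights (possibly zero for buyers without budget) that certify the
optimality of a primal solution. -/
theorem IsPrimalSolution.exists_multipliers {B : Fin n → ℝ} {v : Fin n → Fin m → ℝ → ℝ}
    (hv : ∀ i j, IsValuation (v i j)) {x : Fin n → Fin m → ℝ} {u δ : Fin n → ℝ}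
    (h : IsPrimalSolution B v x u δ) (hB : ∀ i, 0 ≤ B i) :
    (∀ i, B i / u i ≤ 1) ∧
      ∑ i, ∑ j, B i / u i * v i j (x i j) ≤ ∑ i, (B i - δ i) ∧
      ∃ p : Fin m → ℝ, (∀ j, 0 ≤ p j) ∧ (∀ j, p j * ∑ i, x i j = p j) ∧
        ∀ i j t, 0 ≤ t →
          B i / u i * v i j t - p j * t ≤ B i / u i * v i j (x i j) - p j * x i j := by
  have hf := h.feasible
  have ha0 : ∀ i, 0 ≤ B i / u i := fun i => div_nonneg (hB i) (hf.u_nonneg i)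
  have ha1 : ∀ i, B i / u i ≤ 1 := by
    intro i
    -- If the weight exceeded `1`, raising `δ i` by a large `K` would gain `c * K` in the linearized
    -- objective, violating its bound.
    by_contra! hi
    set c := B i / u i - 1 with hc
    have hc0 : 0 < c := sub_pos.2 hi
    obtain ⟨K, hK0, hK⟩ : ∃ K : ℝ, 0 ≤ K ∧ ∑ i, (B i - δ i) < c * K := by
      refine ⟨(|∑ i, (B i - δ i)| + 1) / c, by positivity, ?_⟩
      rw [mul_div_cancel₀ _ hc0.ne']
      linarith [le_abs_self (∑ i, (B i - δ i))]
    have hl := h.linearization hv hB (y := fun _ _ => 0) (δ' := Pi.single i K)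
      (fun _ _ => le_rfl) (by simp) (fun k => by
        by_cases hk : k = i
        · subst hk; simpa using hK0
        · simp [hk])
    have : ∑ k, (B k / u k * (∑ j, v k j 0 + (Pi.single i K : Fin n → ℝ) k)
        - (Pi.single i K : Fin n → ℝ) k) = c * K := by
      rw [Finset.sum_eq_single i]
      · simp [(hv _ _).zero, hc]; ring
      · intro k _ hk; simp [(hv _ _).zero, hk]
      · simp
    linarith
  have hlin : ∀ y : Fin n → Fin m → ℝ, (∀ i j, 0 ≤ y i j) → (∀ j, ∑ i, y i j ≤ 1) →
      ∑ i, ∑ j, B i / u i * v i j (y i j) ≤ ∑ i, (B i - δ i) := by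
    intro y hy hys
    have := h.linearization hv hB hy hys (δ' := fun _ => 0) (fun _ => le_rfl)
    simpa [Finset.mul_sum] using this
  -- Together with `hlin`, this shows that `x` maximizes the linearized welfare, which separates
  -- over goods.
  have hmax : ∑ i, (B i - δ i) ≤ ∑ i, ∑ j, B i / u i * v i j (x i j) := by
    refine Finset.sum_le_sum fun i _ => ?_
    have h1 : B i = B i / u i * u i := by
      rcases (hB i).eq_or_lt with hi | hi
      · simp [← hi]
      · rw [div_mul_cancel₀ _ (hf.u_pos i hi).ne']
    have h2 := mul_le_mul_of_nonneg_left (hf.utility i) (ha0 i)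
    have h3 := mul_le_mul_of_nonneg_right (ha1 i) (hf.δ_nonneg i)
    rw [← Finset.mul_sum]
    linarith
  refine ⟨ha1, hlin x hf.x_nonneg hf.supply, ?_⟩
  have hgood : ∀ j, ∃ p : ℝ, 0 ≤ p ∧ p * ∑ i, x i j = p ∧ ∀ i t, 0 ≤ t →
      B i / u i * v i j t - p * t ≤ B i / u i * v i j (x i j) - p * x i j := by
    intro j
    refine exists_price (f := fun i t => B i / u i * v i j t) (x := fun i => x i j)
      (fun i => ?_) (fun i => hf.x_nonneg i j) (hf.supply j) ?_
    · exact (hv i j).concave.smul (ha0 i)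
    · intro y hy hys
      have hl := (hlin (fun i k => if k = j then y i else x i k) (fun i k => by
          split_ifs
          · exact hy i
          · exact hf.x_nonneg i k) (fun k => by
          by_cases hk : k = j
          · simpa [hk] using hys
          · simpa [hk] using hf.supply k)).trans hmax
      rw [Finset.sum_comm, Finset.sum_comm (f := fun i j => B i / u i * v i j (x i j)),
        ← Finset.add_sum_erase _ _ (Finset.mem_univ j),
        ← Finset.add_sum_erase _ (fun j => ∑ i, B i / u i * v i j (x i j)) (Finset.mem_univ j)]
        at hl
      have he : ∑ k ∈ Finset.univ.erase j, ∑ i, B i / u i * v i k (if k = j then y i else x i k)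
          = ∑ k ∈ Finset.univ.erase j, ∑ i, B i / u i * v i k (x i k) :=
        Finset.sum_congr rfl fun k hk => by simp [Finset.ne_of_mem_erase hk]
      rw [he] at hl
      simpa only [if_true] using le_of_add_le_add_right hl
  choose p hp using hgood
  exact ⟨p, fun j => (hp j).1, fun j => (hp j).2.1, fun i j => (hp j).2.2 i⟩

/-- A dual solution does not cost more than a primal solution. -/
theorem strong_duality {B : Fin n → ℝ} {v : Fin n → Fin m → ℝ → ℝ} (hB : ∀ i, 0 ≤ B i)
    (hv : ∀ i j, IsValuation (v i j)) {x : Fin n → Fin m → ℝ} {u δ α : Fin n → ℝ} {p : Fin m → ℝ}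
    (hprimal : IsPrimalSolution B v x u δ) (hdual : IsDualSolution B v α p) :
    dualObj B v α p ≤ primalObj B u δ := by
  obtain ⟨ha1, hsum, q, hq0, hqs, hq⟩ := hprimal.exists_multipliers hv hB
  have hf := hprimal.feasible
  set C := ∑ i, ∑ j, v i j 1 with hC
  have hv1 : ∀ i j, 0 ≤ v i j 1 := fun i j => (hv i j).nonneg zero_le_one
  have hC0 : 0 ≤ C := Finset.sum_nonneg fun i _ => Finset.sum_nonneg fun j _ => hv1 i j
  have hvC : ∀ i j, v i j 1 ≤ C := fun i j =>
    (Finset.single_le_sum (f := fun j => v i j 1) (fun j _ => hv1 i j) (Finset.mem_univ j)).trans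
      (Finset.single_le_sum (f := fun i => ∑ j, v i j 1)
        (fun i _ => Finset.sum_nonneg fun j _ => hv1 i j) (Finset.mem_univ i))
  -- The multipliers `B i / u i` vanish for buyers without budget, but the dual requires `α i > 0`.
  -- Such buyers get weight `ε`, and raising all prices by `ε * C` absorbs the linear growth of
  -- their valuations.
  have key : ∀ ε : ℝ, 0 < ε → ε ≤ 1 →
      dualObj B v α p ≤ primalObj B u δ + ε * (m * C + C) := by
    intro ε hε hε1
    set a : Fin n → ℝ := fun i => if B i = 0 then ε else B i / u i with ha
    set r : Fin m → ℝ := fun j => q j + ε * C with hr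
    have hbound : ∀ i j t, 0 ≤ t → a i * v i j t - r j * t
        ≤ B i / u i * v i j (x i j) - q j * x i j + ε * v i j 1 := by
      intro i j t ht
      have hqt := hq i j t ht
      have h1 : 0 ≤ ε * C * t := by positivity
      have h2 : 0 ≤ ε * v i j 1 := mul_nonneg hε.le (hv1 i j)
      simp only [ha, hr]
      split_ifs with hi
      · have h3 := mul_le_mul_of_nonneg_left ((hv i j).le_affine ht) hε.le
        have h4 : ε * (v i j 1 * t) ≤ ε * (C * t) := by gcongr; exact hvC i j
        have h5 := hq i j 0 le_rfl
        have h6 := mul_nonneg (hq0 j) ht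
        rw [hi, zero_div, zero_mul, mul_zero] at *
        linarith
      · linarith
    have hfeas : DualFeasible v a r := by
      refine ⟨fun i => ?_, fun i => ?_, fun j => ?_, fun i j => ?_⟩
      · simp only [ha]
        split_ifs with hi
        · exact hε
        · have hi' := lt_of_le_of_ne (hB i) (Ne.symm hi)
          exact div_pos hi' (hf.u_pos i hi')
      · simp only [ha]
        split_ifs
        exacts [hε1, ha1 i]
      · exact add_nonneg (hq0 j) (by positivity)
      · refine ⟨B i / u i * v i j (x i j) - q j * x i j + ε * v i j 1, ?_⟩
        rintro _ ⟨t, ht, rfl⟩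
        exact hbound i j t ht
    refine (hdual.optimal a r hfeas).trans ?_
    have hsup : ∀ i j, sSup ((fun t : ℝ => a i * v i j t - r j * t) '' Set.Ici 0)
        ≤ B i / u i * v i j (x i j) - q j * x i j + ε * v i j 1 := fun i j => by
      refine csSup_le (Set.nonempty_Ici.image _) ?_
      rintro _ ⟨t, ht, rfl⟩
      exact hbound i j t ht
    have hsups := Finset.sum_le_sum fun i (_ : i ∈ Finset.univ) =>
      Finset.sum_le_sum fun j (_ : j ∈ Finset.univ) => hsup i j
    have hlog : ∑ i, (B i * Real.log (B i / a i) - B i) = ∑ i, (B i * Real.log (u i) - B i) := by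
      refine Finset.sum_congr rfl fun i _ => ?_
      by_cases hi : B i = 0
      · simp [hi]
      · simp only [ha, if_neg hi]
        rw [div_div_cancel₀ hi]
    have hrsum : ∑ j, r j = ∑ j, q j + m * (ε * C) := by
      simp [hr, Finset.sum_add_distrib]
    have hx : ∑ i, ∑ j, q j * x i j = ∑ j, q j := by
      rw [Finset.sum_comm]
      exact Finset.sum_congr rfl fun j _ => by rw [← Finset.mul_sum, hqs j]
    simp only [Finset.sum_add_distrib, Finset.sum_sub_distrib] at hsups
    rw [hx] at hsups
    have hεC : ∑ i, ∑ j, ε * v i j 1 = ε * C := by simp only [hC, Finset.mul_sum]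
    rw [hεC] at hsups
    unfold dualObj primalObj
    rw [hlog, hrsum]
    simp only [Finset.sum_sub_distrib] at hsum ⊢
    linarith
  refine le_of_forall_pos_le_add fun η hη => ?_
  have hK : 0 ≤ m * C + C := by positivity
  have h1 := key (min 1 (η / (m * C + C + 1))) (lt_min one_pos (by positivity)) (min_le_left _ _)
  have h2 : min 1 (η / (m * C + C + 1)) * (m * C + C) ≤ η := by
    calc min 1 (η / (m * C + C + 1)) * (m * C + C)
        ≤ η / (m * C + C + 1) * (m * C + C + 1) := by
          exact mul_le_mul (min_le_right _ _) (by linarith) hK (by positivity)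
      _ = η := by field_simp
  linarith

/-! ### Complementary slackness -/

/-- The equilibrium conditions satisfied by a primal and a dual solution. -/
structure IsEquilibrium (B : Fin n → ℝ) (v : Fin n → Fin m → ℝ → ℝ)
    (x : Fin n → Fin m → ℝ) (u δ α : Fin n → ℝ) (p : Fin m → ℝ) : Prop where
  weighted_utility : ∀ i, α i * u i = B i
  utility_eq : ∀ i, u i = ∑ j, v i j (x i j) + δ i
  no_saving : ∀ i, (1 - α i) * δ i = 0
  demand : ∀ i j t, 0 ≤ t → α i * v i j t - p j * t ≤ α i * v i j (x i j) - p j * x i j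
  clearing : ∀ j, p j * ∑ i, x i j = p j

/-- For `B > 0` the gap is `B * (z - 1 - log z)` with `z = a * u / B`, and `log z ≤ z - 1` is strict
away from `z = 1`. -/
theorem mul_log_gap {B a u : ℝ} (hB : 0 ≤ B) (ha : 0 < a) (hu : 0 ≤ u) (hBu : 0 < B → 0 < u) :
    0 ≤ B * Real.log (B / a) - B + a * u - B * Real.log u ∧
      (B * Real.log (B / a) - B + a * u - B * Real.log u = 0 → a * u = B) := by
  rcases hB.eq_or_lt with rfl | hB
  · exact ⟨by simpa using mul_nonneg ha.le hu, fun h => by simpa using h⟩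
  · have hu := hBu hB
    have hz : 0 < a * u / B := by positivity
    have hlog : Real.log (a * u / B) = Real.log u - Real.log (B / a) := by
      rw [← Real.log_div hu.ne' (by positivity)]
      congr 1
      field_simp
    have hgap : B * Real.log (B / a) - B + a * u - B * Real.log u
        = B * (a * u / B - 1 - Real.log (a * u / B)) := by
      rw [hlog]
      field_simp
      ring
    rw [hgap]
    refine ⟨mul_nonneg hB.le (by linarith [Real.log_le_sub_one_of_pos hz]), fun h => ?_⟩
    by_contra hne
    have h1 := Real.log_lt_sub_one_of_pos hz (fun h => hne ((div_eq_one_iff_eq hB.ne').1 h))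
    have := mul_pos hB (sub_pos.2 h1)
    linarith

theorem complementary_slackness {B : Fin n → ℝ} {v : Fin n → Fin m → ℝ → ℝ} (hB : ∀ i, 0 ≤ B i)
    {x : Fin n → Fin m → ℝ} {u δ α : Fin n → ℝ} {p : Fin m → ℝ}
    (hf : PrimalFeasible B v x u δ) (hd : DualFeasible v α p)
    (h : dualObj B v α p ≤ primalObj B u δ) : IsEquilibrium B v x u δ α p := by
  set S : Fin n → Fin m → ℝ := fun i j =>
    sSup ((fun t : ℝ => α i * v i j t - p j * t) '' Set.Ici 0) with hS
  have hle : ∀ i j t, 0 ≤ t → α i * v i j t - p j * t ≤ S i j := fun i j t ht =>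
    le_csSup (hd.bdd i j) ⟨t, ht, rfl⟩
  have hg := fun i => mul_log_gap (hB i) (hd.α_pos i) (hf.u_nonneg i) (hf.u_pos i)
  have hA : ∀ i ∈ Finset.univ, 0 ≤ B i * Real.log (B i / α i) - B i + α i * u i
      - B i * Real.log (u i) := fun i _ => (hg i).1
  have hU : ∀ i ∈ Finset.univ, 0 ≤ α i * (∑ j, v i j (x i j) + δ i - u i) := fun i _ =>
    mul_nonneg (hd.α_pos i).le (sub_nonneg.2 (hf.utility i))
  have hN : ∀ i ∈ Finset.univ, 0 ≤ (1 - α i) * δ i := fun i _ =>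
    mul_nonneg (sub_nonneg.2 (hd.α_le_one i)) (hf.δ_nonneg i)
  have hD : ∀ i j, 0 ≤ S i j - (α i * v i j (x i j) - p j * x i j) := fun i j =>
    sub_nonneg.2 (hle i j _ (hf.x_nonneg i j))
  have hD' : ∀ i ∈ Finset.univ, 0 ≤ ∑ j, (S i j - (α i * v i j (x i j) - p j * x i j)) :=
    fun i _ => Finset.sum_nonneg fun j _ => hD i j
  have hE : ∀ j ∈ Finset.univ, 0 ≤ p j * (1 - ∑ i, x i j) := fun j _ =>
    mul_nonneg (hd.p_nonneg j) (sub_nonneg.2 (hf.supply j))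
  -- The duality gap is a sum of five nonnegative groups of terms, so a nonpositive gap forces every
  -- term to vanish.
  have hsum : ∑ i, (B i * Real.log (B i / α i) - B i + α i * u i - B i * Real.log (u i))
      + ∑ i, α i * (∑ j, v i j (x i j) + δ i - u i) + ∑ i, (1 - α i) * δ i
      + ∑ i, ∑ j, (S i j - (α i * v i j (x i j) - p j * x i j))
      + ∑ j, p j * (1 - ∑ i, x i j) = dualObj B v α p - primalObj B u δ := by
    have hx : ∑ j, p j * ∑ i, x i j = ∑ i, ∑ j, p j * x i j := by
      simp only [Finset.mul_sum]
      exact Finset.sum_comm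
    unfold dualObj primalObj
    simp only [mul_add, mul_sub, sub_mul, one_mul, mul_one, Finset.sum_add_distrib,
      Finset.sum_sub_distrib, hx]
    simp only [Finset.mul_sum, hS]
    ring
  have hA0 := Finset.sum_nonneg hA
  have hU0 := Finset.sum_nonneg hU
  have hN0 := Finset.sum_nonneg hN
  have hD0 := Finset.sum_nonneg hD'
  have hE0 := Finset.sum_nonneg hE
  have hA1 := (Finset.sum_eq_zero_iff_of_nonneg hA).1 (by linarith)
  have hU1 := (Finset.sum_eq_zero_iff_of_nonneg hU).1 (by linarith)
  have hN1 := (Finset.sum_eq_zero_iff_of_nonneg hN).1 (by linarith)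
  have hD1 := (Finset.sum_eq_zero_iff_of_nonneg hD').1 (by linarith)
  have hE1 := (Finset.sum_eq_zero_iff_of_nonneg hE).1 (by linarith)
  refine ⟨fun i => (hg i).2 (hA1 i (Finset.mem_univ i)), fun i => ?_,
    fun i => hN1 i (Finset.mem_univ i), fun i j t ht => ?_, fun j => ?_⟩
  · have := (mul_eq_zero.1 (hU1 i (Finset.mem_univ i))).resolve_left (hd.α_pos i).ne'
    linarith
  · have h1 := (Finset.sum_eq_zero_iff_of_nonneg (fun j _ => hD i j)).1
      (hD1 i (Finset.mem_univ i)) j (Finset.mem_univ j)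
    linarith [hle i j t ht]
  · linarith [hE1 j (Finset.mem_univ j)]

/-! ### Revenue of an equilibrium -/

theorem IsEquilibrium.payment_le {B : Fin n → ℝ} {v : Fin n → Fin m → ℝ → ℝ}
    (hv : ∀ i j, IsValuation (v i j)) {x : Fin n → Fin m → ℝ} {u δ α : Fin n → ℝ} {p : Fin m → ℝ}
    (h : IsEquilibrium B v x u δ α p) (i : Fin n) (j : Fin m) :
    p j * x i j ≤ α i * v i j (x i j) := by
  have := h.demand i j 0 le_rfl
  rw [(hv i j).zero, mul_zero, mul_zero, sub_zero] at this
  linarith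

theorem RMVUP_nonneg (B : Fin n → ℝ) (v : Fin n → Fin m → ℝ → ℝ) : 0 ≤ RMVUP B v := by
  refine Real.sSup_nonneg ?_
  rintro _ ⟨y, b, hb, rfl⟩
  exact Finset.sum_nonneg fun i _ => Finset.sum_nonneg fun j _ => hb.b_nonneg i j

theorem RMVUP_eq_zero (B : Fin n → ℝ) {v : Fin n → Fin m → ℝ → ℝ}
    (hv : ∀ i j t, 0 ≤ t → v i j t = 0) : RMVUP B v = 0 := by
  refine le_antisymm (Real.sSup_le ?_ le_rfl) (RMVUP_nonneg B v)
  rintro _ ⟨y, b, hb, rfl⟩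
  exact Finset.sum_nonpos fun i _ => Finset.sum_nonpos fun j _ =>
    (hb.rational i j).trans (hv i j _ (hb.x_nonneg i j)).le

/-- If equilibrium payments recover a `1 / ρ` fraction of the weighted values, then the revenue is
at least a `1 / (ρ + 1)` fraction of the benchmark. -/
theorem IsEquilibrium.RMVUP_le {B : Fin n → ℝ} {v : Fin n → Fin m → ℝ → ℝ} {ρ : ℝ}
    (hρ0 : 0 ≤ ρ) {x : Fin n → Fin m → ℝ} {u δ α : Fin n → ℝ} {p : Fin m → ℝ}
    (h : IsEquilibrium B v x u δ α p) (hα : ∀ i, α i ≤ 1) (hp : ∀ j, 0 ≤ p j)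
    (hx : ∀ i j, 0 ≤ x i j) (hρ : ∀ i j, α i * v i j (x i j) ≤ ρ * (p j * x i j)) :
    RMVUP B v ≤ (ρ + 1) * ∑ i, ∑ j, p j * x i j := by
  have hpx : ∀ i j, 0 ≤ p j * x i j := fun i j => mul_nonneg (hp j) (hx i j)
  have hrev : ∑ i, ∑ j, p j * x i j = ∑ j, p j := by
    rw [Finset.sum_comm]
    exact Finset.sum_congr rfl fun j _ => by rw [← Finset.mul_sum, h.clearing j]
  have hrev0 : 0 ≤ ∑ i, ∑ j, p j * x i j :=
    Finset.sum_nonneg fun i _ => Finset.sum_nonneg fun j _ => hpx i j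
  refine Real.sSup_le ?_ (mul_nonneg (by linarith) hrev0)
  rintro _ ⟨y, b, hb, rfl⟩
  have hbuyer : ∀ i, ∑ j, b i j ≤ ρ * ∑ j, p j * x i j + ∑ j, p j * y i j := by
    intro i
    rw [Finset.mul_sum]
    rcases (hα i).eq_or_lt with hi | hi
    · rw [← Finset.sum_add_distrib]
      refine Finset.sum_le_sum fun j _ => ?_
      have h1 := hb.rational i j
      have h2 := h.demand i j _ (hb.x_nonneg i j)
      have h3 := hρ i j
      have h4 := hpx i j
      rw [hi, one_mul] at h2 h3
      linarith
    · have h1 := (mul_eq_zero.1 (h.no_saving i)).resolve_left (sub_pos.2 hi).ne'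
      have h2 := h.weighted_utility i
      rw [h.utility_eq i, h1, add_zero, Finset.mul_sum] at h2
      have h3 : 0 ≤ ∑ j, p j * y i j :=
        Finset.sum_nonneg fun j _ => mul_nonneg (hp j) (hb.x_nonneg i j)
      linarith [hb.budget i, Finset.sum_le_sum fun j (_ : j ∈ Finset.univ) => hρ i j]
  have hy : ∑ i, ∑ j, p j * y i j ≤ ∑ i, ∑ j, p j * x i j := by
    rw [hrev, Finset.sum_comm]
    refine Finset.sum_le_sum fun j _ => ?_
    rw [← Finset.mul_sum]
    exact mul_le_of_le_one_right (hp j) (hb.supply j)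
  have := Finset.sum_le_sum fun i (_ : i ∈ Finset.univ) => hbuyer i
  rw [Finset.sum_add_distrib, ← Finset.mul_sum] at this
  linarith

/-! ### Slopes -/

theorem IsValuation.le_derivWithin_mul {f : ℝ → ℝ} (hf : IsValuation f)
    (hd : DifferentiableWithinAt ℝ f (Set.Ici 0) 0) {t : ℝ} (ht : 0 ≤ t) :
    f t ≤ derivWithin f (Set.Ici 0) 0 * t := by
  rcases ht.eq_or_lt with rfl | ht
  · simp [hf.zero]
  · have := hf.concave.slope_le_derivWithin (Set.mem_Ici.2 le_rfl) (Set.mem_Ici.2 ht.le) ht hd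
    rw [slope_def_field, hf.zero, sub_zero, sub_zero, div_le_iff₀ ht] at this
    exact this

theorem IsValuation.deriv_one_le {f : ℝ → ℝ} (hf : IsValuation f) (hd : DifferentiableAt ℝ f 1)
    {t : ℝ} (ht : 0 ≤ t) (ht1 : t < 1) : deriv f 1 * (1 - t) ≤ f 1 - f t := by
  have := hf.concave.deriv_le_slope (Set.mem_Ici.2 ht) (Set.mem_Ici.2 zero_le_one) ht1 hd
  rwa [slope_def_field, le_div_iff₀ (sub_pos.2 ht1)] at this

theorem IsValuation.deriv_one_le_deriv {f : ℝ → ℝ} (hf : IsValuation f)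
    (hd : DifferentiableAt ℝ f 1) {t : ℝ} (ht : 0 < t) (ht1 : t ≤ 1)
    (hdt : DifferentiableAt ℝ f t) : deriv f 1 ≤ deriv f t := by
  rcases ht1.eq_or_lt with rfl | ht1
  · exact le_rfl
  · exact (hf.concave.deriv_le_slope (Set.mem_Ici.2 ht.le) (Set.mem_Ici.2 zero_le_one) ht1 hd).trans
      (hf.concave.slope_le_deriv (Set.mem_Ici.2 ht.le) (Set.mem_Ici.2 zero_le_one) ht1 hdt)

/-- If `t * f' t` is nondecreasing on `(0, 1]` and the slopes of `f` at `0` and `1` differ at most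
by the factor `r`, then `f t` exceeds `t * f' t` at most by the factor `1 + log r`. -/
theorem IsValuation.le_one_add_log_mul {f : ℝ → ℝ} (hf : IsValuation f) (hs : RegularSlopes f)
    (hd : ∀ t ∈ Set.Ioo (0 : ℝ) 1, DifferentiableAt ℝ f t)
    (hm : MonotoneOn (fun t : ℝ => t * deriv f t) (Set.Ioc 0 1)) {r : ℝ} (hr : 1 ≤ r)
    (hslope : derivWithin f (Set.Ici 0) 0 ≤ r * deriv f 1) {t : ℝ} (ht : 0 < t) (ht1 : t ≤ 1) :
    f t ≤ (1 + Real.log r) * (t * deriv f t) := by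
  have hd' : ∀ s, 0 < s → s ≤ 1 → DifferentiableAt ℝ f s := fun s h0 h1 => by
    rcases h1.eq_or_lt with rfl | h1
    · exact hs.diff_one
    · exact hd s ⟨h0, h1⟩
  have hr0 : 0 < r := by linarith
  set c := t * deriv f t with hc
  -- Below `t / r` the slope at `0` already gives `f (t / r) ≤ c`; from there to `t`, the bound `f'
  -- s ≤ c / s` adds at most `c * log r`.
  have hs0 : 0 < t / r := by positivity
  have hst : t / r ≤ t := div_le_self ht.le hr
  have hder : ∀ s ∈ Set.Icc (t / r) t,
      HasDerivAt (fun s => f s - c * Real.log s) (deriv f s - c * s⁻¹) s := fun s hs' =>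
    (hd' s (hs0.trans_le hs'.1) (hs'.2.trans ht1)).hasDerivAt.sub
      ((Real.hasDerivAt_log (hs0.trans_le hs'.1).ne').const_mul c)
  have hanti : AntitoneOn (fun s => f s - c * Real.log s) (Set.Icc (t / r) t) := by
    refine antitoneOn_of_deriv_nonpos (convex_Icc _ _)
      (fun s hs' => (hder s hs').continuousAt.continuousWithinAt)
      (fun s hs' => (hder s (interior_subset hs')).differentiableAt.differentiableWithinAt)
      fun s hs' => ?_
    have hs' := interior_subset hs'
    have hpos := hs0.trans_le hs'.1
    rw [(hder s hs').deriv, sub_nonpos, ← div_eq_mul_inv, le_div_iff₀ hpos, mul_comm]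
    exact hm ⟨hpos, hs'.2.trans ht1⟩ ⟨ht, ht1⟩ hs'.2
  have h1 := hanti ⟨le_rfl, hst⟩ ⟨hst, le_rfl⟩ hst
  simp only [Real.log_div ht.ne' hr0.ne'] at h1
  have h2 : f (t / r) ≤ c := by
    calc f (t / r) ≤ derivWithin f (Set.Ici 0) 0 * (t / r) :=
          hf.le_derivWithin_mul hs.diff_zero hs0.le
      _ ≤ r * deriv f t * (t / r) := by
          gcongr
          refine hslope.trans ?_
          gcongr
          exact hf.deriv_one_le_deriv hs.diff_one ht ht1 (hd' t ht ht1)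
      _ = c := by rw [hc]; field_simp
  linarith

/-- The slope ratio is `1` or more unless all valuations vanish, and then it bounds the slopes. -/
theorem one_le_slopeRatio {v : Fin n → Fin m → ℝ → ℝ} (hv : ∀ i j, IsValuation (v i j))
    (hs : ∀ i j, RegularSlopes (v i j)) (i : Fin n) (j : Fin m)
    (hne : ¬ ∀ t, 0 ≤ t → v i j t = 0) :
    1 ≤ slopeRatio v ∧
      derivWithin (v i j) (Set.Ici 0) 0 ≤ slopeRatio v * deriv (v i j) 1 := by
  have hpos := (hs i j).pos_or_zero.resolve_right hne
  have hle : derivWithin (v i j) (Set.Ici 0) 0 / deriv (v i j) 1 ≤ slopeRatio v :=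
    le_ciSup (f := fun ij : Fin n × Fin m =>
      derivWithin (v ij.1 ij.2) (Set.Ici 0) 0 / deriv (v ij.1 ij.2) 1)
      (Set.finite_range _).bddAbove (i, j)
  have h1 := (hv i j).deriv_one_le (hs i j).diff_one le_rfl zero_lt_one
  have h2 := (hv i j).le_derivWithin_mul (hs i j).diff_zero zero_le_one
  rw [(hv i j).zero] at h1
  refine ⟨le_trans ?_ hle, (div_le_iff₀ hpos).1 hle⟩
  rw [le_div_iff₀ hpos]
  linarith

/-- A price at which a demanded quantity is positive is a multiple of the slope there. -/
theorem mul_deriv_eq_of_demand {f : ℝ → ℝ} {a q x : ℝ} (hx : 0 < x)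
    (hmax : ∀ t, 0 ≤ t → a * f t - q * t ≤ a * f x - q * x) (hd : DifferentiableAt ℝ f x) :
    a * deriv f x = q := by
  have h1 : IsLocalMax (fun t => a * f t - q * t) x := by
    filter_upwards [lt_mem_nhds hx] with t ht using hmax t ht.le
  have h2 : HasDerivAt (fun t => a * f t - q * t) (a * deriv f x - q * 1) x :=
    (hd.hasDerivAt.const_mul a).sub ((hasDerivAt_id x).const_mul q)
  linarith [h1.hasDerivAt_eq_zero h2]

/-- At an interior demand, moving on to quantity `1` is unprofitable, while concavity makes it gain
at least slope `deriv f 1`. At `x = 1` the first-order condition applies. -/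
theorem mul_deriv_one_le_of_demand {f : ℝ → ℝ} (hf : IsValuation f) {a q x : ℝ} (ha : 0 ≤ a)
    (hx : 0 ≤ x) (hx1 : x ≤ 1)
    (hmax : ∀ t, 0 ≤ t → a * f t - q * t ≤ a * f x - q * x) (hd : DifferentiableAt ℝ f 1) :
    a * deriv f 1 ≤ q := by
  rcases hx1.eq_or_lt with rfl | hx1
  · exact (mul_deriv_eq_of_demand one_pos hmax hd).le
  · have h1 := mul_le_mul_of_nonneg_left (hf.deriv_one_le hd hx hx1) ha
    have h2 := hmax 1 zero_le_one
    refine le_of_mul_le_mul_right ?_ (sub_pos.2 hx1)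
    linarith

/-! ### Comparison of the approximation factors -/

theorem one_div_mul_le_of_le_mul {ρ₀ ρ R V : ℝ} (hρ : 1 ≤ ρ) (h : ρ₀ + 1 ≤ ρ * (ρ + 1))
    (hV : 0 ≤ V) (hR : R ≤ (ρ₀ + 1) * V) : 1 / (ρ * (ρ + 1)) * R ≤ V := by
  have hpos : 0 < ρ * (ρ + 1) := by positivity
  rw [one_div, inv_mul_le_iff₀ hpos]
  exact hR.trans (mul_le_mul_of_nonneg_right h hV)

theorem log_add_two_le_logb {r : ℝ} (hr : 1 ≤ r) :
    1 ≤ Real.logb 2 (1 + r) ∧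
      1 + Real.log r + 1 ≤ Real.logb 2 (1 + r) * (Real.logb 2 (1 + r) + 1) := by
  have hl2 := Real.log_pos one_lt_two
  have hl2' : Real.log 2 < 1 := Real.log_two_lt_d9.trans (by norm_num)
  set s := (1 + r) / 2 with hs
  have hs1 : 1 ≤ s := by rw [hs]; linarith
  have hs0 : 0 < s := by linarith
  have hls := Real.log_nonneg hs1
  have hL : Real.logb 2 (1 + r) = 1 + Real.log s / Real.log 2 := by
    rw [show 1 + r = 2 * s by rw [hs]; ring, Real.logb, Real.log_mul two_ne_zero hs0.ne', add_div,
      div_self hl2.ne']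
  have hq : Real.log s ≤ Real.log s / Real.log 2 := le_div_self hls hl2 hl2'.le
  -- AM-GM: `r ≤ ((1 + r) / 2) ^ 2`.
  have hlog : Real.log r ≤ 2 * Real.log s := by
    have : Real.log r ≤ Real.log (s ^ 2) :=
      Real.log_le_log (by linarith) (by rw [hs]; nlinarith [sq_nonneg (r - 1)])
    simpa [Real.log_pow] using this
  rw [hL]
  constructor
  · linarith
  -- With `q = log s / log 2`, the right side is `(1 + q) * (2 + q) = 2 + 3 * q + q ^ 2`, and `log r
  -- ≤ 2 * q`.
  · nlinarith [sq_nonneg (Real.log s / Real.log 2)]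

end ConcaveMarket

/-! ### Rationality, budget feasibility and revenue of the optimal solutions. -/

open ConcaveMarket in
theorem theorem6p1 {n m : ℕ} (B : Fin n → ℝ) (hB : ∀ i, 0 ≤ B i)
    (v : Fin n → Fin m → ℝ → ℝ) (hv : ∀ i j, ConcaveMarket.IsValuation (v i j))
    (x : Fin n → Fin m → ℝ) (u δ : Fin n → ℝ) (α : Fin n → ℝ) (p : Fin m → ℝ)
    (hprimal : ConcaveMarket.IsPrimalSolution B v x u δ)
    (hdual : ConcaveMarket.IsDualSolution B v α p) :
    -- individual rationality
    (∀ i j, p j * x i j ≤ v i j (x i j)) ∧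
    -- budget feasibility
    (∀ i, ∑ j, p j * x i j ≤ B i) ∧
    -- revenue guarantee for general concave valuations
    ((∀ i j, ConcaveMarket.RegularSlopes (v i j)) →
      ∀ ρ : ℝ, ρ = ConcaveMarket.slopeRatio v →
        1 / (ρ * (ρ + 1)) * ConcaveMarket.RMVUP B v ≤ ∑ i, ∑ j, p j * x i j) ∧
    -- revenue guarantee when `t * v'(t)` is nondecreasing
    ((∀ i j, ConcaveMarket.RegularSlopes (v i j)) →
      (∀ i j, ∀ t ∈ Set.Ioo (0 : ℝ) 1, DifferentiableAt ℝ (v i j) t) →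
      (∀ i j, MonotoneOn (fun t : ℝ => t * deriv (v i j) t) (Set.Ioc 0 1)) →
      ∀ ρ : ℝ, (ρ = 1 + Real.log (ConcaveMarket.slopeRatio v) ∨
          ρ = Real.logb 2 (1 + ConcaveMarket.slopeRatio v)) →
        1 / (ρ * (ρ + 1)) * ConcaveMarket.RMVUP B v ≤ ∑ i, ∑ j, p j * x i j) := by
  have hf := hprimal.feasible
  have hd := hdual.feasible
  have heq := complementary_slackness hB hf hd (strong_duality hB hv hprimal hdual)
  have hpay := heq.payment_le hv
  have hrev0 : 0 ≤ ∑ i, ∑ j, p j * x i j := Finset.sum_nonneg fun i _ =>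
    Finset.sum_nonneg fun j _ => mul_nonneg (hd.p_nonneg j) (hf.x_nonneg i j)
  have hx1 : ∀ i j, x i j ≤ 1 := fun i j =>
    (Finset.single_le_sum (f := fun i => x i j) (fun i _ => hf.x_nonneg i j)
      (Finset.mem_univ i)).trans (hf.supply j)
  have hzero : (∀ i j t, 0 ≤ t → v i j t = 0) → ∀ c : ℝ,
      c * RMVUP B v ≤ ∑ i, ∑ j, p j * x i j := fun h c => by
    rw [RMVUP_eq_zero B h, mul_zero]
    exact hrev0
  refine ⟨fun i j => (hpay i j).trans (mul_le_of_le_one_left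
      ((hv i j).nonneg (hf.x_nonneg i j)) (hd.α_le_one i)), fun i => ?_, ?_, ?_⟩
  · have h1 := Finset.sum_le_sum fun j (_ : j ∈ Finset.univ) => hpay i j
    have h2 := mul_nonneg (hd.α_pos i).le (hf.δ_nonneg i)
    rw [← Finset.mul_sum] at h1
    have h3 := heq.weighted_utility i
    rw [heq.utility_eq i] at h3
    linarith
  · rintro hs _ rfl
    -- Only when some valuation is nonzero is the slope ratio known to be at least `1`.
    by_cases hall : ∀ i j t, 0 ≤ t → v i j t = 0
    · exact hzero hall _
    simp only [not_forall] at hall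
    obtain ⟨i₀, j₀, hne⟩ := hall
    have hr := (one_le_slopeRatio hv hs i₀ j₀ (by simpa using hne)).1
    refine one_div_mul_le_of_le_mul hr (by nlinarith) hrev0
      (heq.RMVUP_le (by linarith) hd.α_le_one hd.p_nonneg hf.x_nonneg fun i j => ?_)
    by_cases hz : ∀ t, 0 ≤ t → v i j t = 0
    · rw [hz _ (hf.x_nonneg i j), mul_zero]
      exact mul_nonneg (by linarith) (mul_nonneg (hd.p_nonneg j) (hf.x_nonneg i j))
    have h1 := mul_deriv_one_le_of_demand (hv i j) (hd.α_pos i).le (hf.x_nonneg i j) (hx1 i j)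
      (heq.demand i j) (hs i j).diff_one
    calc α i * v i j (x i j)
        ≤ α i * (slopeRatio v * deriv (v i j) 1 * x i j) := by
          have h2 := (one_le_slopeRatio hv hs i j hz).2
          exact mul_le_mul_of_nonneg_left
            (((hv i j).le_derivWithin_mul (hs i j).diff_zero (hf.x_nonneg i j)).trans
              (mul_le_mul_of_nonneg_right h2 (hf.x_nonneg i j))) (hd.α_pos i).le
      _ = slopeRatio v * (α i * deriv (v i j) 1 * x i j) := by ring
      _ ≤ slopeRatio v * (p j * x i j) :=
          mul_le_mul_of_nonneg_left (mul_le_mul_of_nonneg_right h1 (hf.x_nonneg i j))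
            (by linarith)
  · intro hs hdiff hmono ρ hρ
    by_cases hall : ∀ i j t, 0 ≤ t → v i j t = 0
    · exact hzero hall _
    simp only [not_forall] at hall
    obtain ⟨i₀, j₀, hne⟩ := hall
    have hr := (one_le_slopeRatio hv hs i₀ j₀ (by simpa using hne)).1
    have hlog := Real.log_nonneg hr
    have hR : RMVUP B v ≤ (1 + Real.log (slopeRatio v) + 1) * ∑ i, ∑ j, p j * x i j := by
      refine heq.RMVUP_le (by linarith) hd.α_le_one hd.p_nonneg hf.x_nonneg fun i j => ?_
      by_cases hz : ∀ t, 0 ≤ t → v i j t = 0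
      · rw [hz _ (hf.x_nonneg i j), mul_zero]
        exact mul_nonneg (by linarith) (mul_nonneg (hd.p_nonneg j) (hf.x_nonneg i j))
      rcases (hf.x_nonneg i j).eq_or_lt with h0 | h0
      · rw [← h0, (hv i j).zero, mul_zero, mul_zero, mul_zero]
      have hdx : DifferentiableAt ℝ (v i j) (x i j) := by
        rcases (hx1 i j).eq_or_lt with h1 | h1
        · rw [h1]
          exact (hs i j).diff_one
        · exact hdiff i j _ ⟨h0, h1⟩
      have h2 := mul_le_mul_of_nonneg_left ((hv i j).le_one_add_log_mul (hs i j) (hdiff i j)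
        (hmono i j) hr (one_le_slopeRatio hv hs i j hz).2 h0 (hx1 i j)) (hd.α_pos i).le
      rw [← mul_deriv_eq_of_demand h0 (heq.demand i j) hdx]
      linarith
    rcases hρ with rfl | rfl
    · exact one_div_mul_le_of_le_mul (by linarith) (by nlinarith) hrev0 hR
    -- The binary logarithm enters only by comparison with the factor `1 + log r + 1` in `hR`.
    · obtain ⟨h1, h2⟩ := log_add_two_le_logb hr
      exact one_div_mul_le_of_le_mul h1 h2 hrev0 hR
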